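/- **Lemma.** Let $\mathbb H^2=\mathbb H^2(\operatorname{Re}(s)>\tfrac12)$ be the Hardy space of analytic functions $F$ on the half-plane $\operatorname{Re}(s)>\frac12$ with $$\sup_{\sigma>1/2}\int_{\operatorname{Re}(s)=\sigma}|F(s)|^2\,\frac{|ds|}{2\pi}<\infty .$$ The boundary value of a function at a point $\frac12+i\tau$ of the critical line is its limit along $\sigma+i\tau$, $\sigma\to\frac12^+$; for $F\in\mathbb H^2$ it exists for almost every $\tau$. An inner function is an analytic function $J$ on $\operatorname{Re}(s)>\frac12$ with $|J|\le 1$ there and boundary values of modulus $1$ almost everywhere. An outer function is a function of the form $$G(s)=c\,\exp\Bigl(\frac1{2\pi}\int_{\operatorname{Re}(s_0)=\frac12}\frac{w(s_0)+w(s)}{w(s_0)-w(s)}\,k(s_0)\,\frac{|ds_0|}{|s_0|^2}\Bigr),\qquad w(s)=\frac{s-1}{s},\quad \operatorname{Re}(s)>\tfrac12,$$ with $|c|=1$ and $k$ a real measurable function satisfying $\int |k(s_0)|\,|s_0|^{-2}\,|ds_0|<\infty$. A function $F_{\rm out}$ is the outer factor of $F$ (determined up to a constant of modulus $1$) if it is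 outer and $F=J\,F_{\rm out}$ for some inner function $J$. Let $F\in\mathbb H^2$ be not identically zero, let $F_{\rm out}$ be its outer factor, and let $K\in\mathbb R$. If $F(s)$ is $O(|s|^K)$ on the critical line, i.e. there is a constant $C$ such that the boundary values of $F$ satisfy $|F(s)|\le C|s|^K$ for almost every $s$ with $\operatorname{Re}(s)=\frac12$, then $F_{\rm out}(s)$ is $O(|s|^K)$ on the entire closed half-plane: there is a constant $C'$ such that $|F_{\rm out}(s)|\le C'|s|^K$ for every $s$ with $\operatorname{Re}(s)>\frac12$, and for almost every $s$ with $\operatorname{Re}(s)=\frac12$, where the boundary values of $F_{\rm out}$ exist. -/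

import Mathlib

open MeasureTheory Filter Topology

noncomputable section

/-- The point `σ + iτ` of the complex plane. -/
def vpt (σ τ : ℝ) : ℂ := (σ : ℂ) + (τ : ℂ) * Complex.I

/-- The point `1/2 + iτ` of the critical line. -/
def critPt (τ : ℝ) : ℂ := vpt (1 / 2) τ

/-- The open half-plane `Re s > 1/2`. -/
def halfPlane : Set ℂ := {s : ℂ | 1 / 2 < s.re}

/-- `sup_{σ > 1/2} ∫_{Re s = σ} |F(s)|² |ds| / 2π`, with values in `[0, ∞]`. -/
def hardyNormSq (F : ℂ → ℂ) : ENNReal :=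
  ⨆ σ : Set.Ioi (1 / 2 : ℝ),
    (∫⁻ τ : ℝ, ‖F (vpt σ τ)‖ₑ ^ 2) / ENNReal.ofReal (2 * Real.pi)

/-- `F` (restricted to the half-plane) belongs to the Hardy space `H²(Re s > 1/2)`. -/
def MemHardyTwo (F : ℂ → ℂ) : Prop :=
  DifferentiableOn ℂ F halfPlane ∧ hardyNormSq F < ⊤

/-- `z` is the boundary value of `F` at `1/2 + iτ`, as limit along the horizontal half-line
inside the half-plane. -/
def HasBoundaryValue (F : ℂ → ℂ) (τ : ℝ) (z : ℂ) : Prop :=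
  Tendsto (fun σ : ℝ => F (vpt σ τ)) (𝓝[>] (1 / 2 : ℝ)) (𝓝 z)

/-- Inner function of the half-plane: analytic, bounded by `1`, with boundary values of
modulus `1` almost everywhere on the critical line. -/
def IsInner (J : ℂ → ℂ) : Prop :=
  DifferentiableOn ℂ J halfPlane ∧ (∀ s ∈ halfPlane, ‖J s‖ ≤ 1) ∧
    ∀ᵐ τ : ℝ, ∃ z : ℂ, HasBoundaryValue J τ z ∧ ‖z‖ = 1

/-- The conformal map `w = (s - 1) / s` from the half-plane `Re s > 1/2` onto the unit disc. -/
def toDisc (s : ℂ) : ℂ := (s - 1) / s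

/-- Outer function of the half-plane: the pull-back under `w = (s - 1) / s` of
`c · exp ((1/2π) ∫ (e^{iθ} + w) / (e^{iθ} - w) k dθ)`, where `|c| = 1` and `k` is real and
integrable for `dθ`. On the critical line, with `e^{iθ} = (s₀ - 1) / s₀`, one has
`dθ = |ds₀| / |s₀|²`. -/
def IsOuter (G : ℂ → ℂ) : Prop :=
  ∃ (c : ℂ) (k : ℝ → ℝ), ‖c‖ = 1 ∧
    Integrable (fun τ : ℝ => k τ / ‖critPt τ‖ ^ 2) ∧
    ∀ s ∈ halfPlane, G s = c * Complex.exp (1 / (2 * (Real.pi : ℂ)) *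
      ∫ τ : ℝ, (toDisc (critPt τ) + toDisc s) / (toDisc (critPt τ) - toDisc s) *
        ((k τ / ‖critPt τ‖ ^ 2 : ℝ) : ℂ))

/-- `G` is an outer factor of `F` (unique up to a constant of modulus `1`):
`F` is the product of an inner function and the outer function `G`. -/
def IsOuterFactor (F G : ℂ → ℂ) : Prop :=
  IsOuter G ∧ ∃ J : ℂ → ℂ, IsInner J ∧ ∀ s ∈ halfPlane, F s = J s * G s

/-- `F` is `O(|s|^K)` on the critical line: almost everywhere the boundary value of `F`
exists and is bounded by `C |s|^K`, with one constant `C`. -/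
def IsBigOOnCriticalLine (F : ℂ → ℂ) (K : ℝ) : Prop :=
  ∃ C : ℝ, ∀ᵐ τ : ℝ, ∃ z : ℂ, HasBoundaryValue F τ z ∧ ‖z‖ ≤ C * ‖critPt τ‖ ^ K

/-- `G` is `O(|s|^K)` on the closed half-plane `Re s ≥ 1/2`: with one constant `C`, the bound
`C |s|^K` holds at every point of the open half-plane and, for the boundary values (which exist
almost everywhere), at almost every point of the critical line. -/
def IsBigOOnClosedHalfPlane (G : ℂ → ℂ) (K : ℝ) : Prop :=
  ∃ C : ℝ, (∀ s ∈ halfPlane, ‖G s‖ ≤ C * ‖s‖ ^ K) ∧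
    ∀ᵐ τ : ℝ, ∃ z : ℂ, HasBoundaryValue G τ z ∧ ‖z‖ ≤ C * ‖critPt τ‖ ^ K

end

/-! Taking real parts in the Schwarz integral shows that `log |Fout|` is the Poisson integral of `k`
(`norm_outer_eq`). An inner factor has unimodular boundary values, so `Fout` inherits the boundary
bound of `F`; by Fatou's theorem (`ae_tendsto_poissonIntegral`) the boundary modulus of `Fout` is
`exp k`, whence `k ≤ log C + K log |s₀|` almost everywhere. The Poisson kernel is positive, so this
inequality may be integrated against it. Its right-hand side reproduces itself: `log |s|` is
harmonic up to the line, its singularity `0` lying to the left, and grows slowly enough to be the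
Poisson integral of its boundary values (`integral_poissonKernelLine_mul_log`). That is an equality,
so the sign of `K` plays no role and the constant `C` is kept. -/

/-! ### The Poisson kernel as uniform measure on the circle -/

/-- The (unnormalized) Poisson kernel `y / (y² + (x - t)²)` of the upper half-plane. -/
noncomputable def poissonKernelLine (y t x : ℝ) : ℝ := y / (y ^ 2 + (x - t) ^ 2)

/-- The parametrization of the real line by the circle for which the Poisson kernel at height `y`
above `t` becomes the uniform measure. -/
noncomputable def lineParam (y t θ : ℝ) : ℝ := t + y * Real.tan (θ / 2 - Real.pi / 2)

theorem cos_half_sub_pos {θ : ℝ} (hθ : θ ∈ Set.Ioo 0 (2 * Real.pi)) :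
    0 < Real.cos (θ / 2 - Real.pi / 2) :=
  Real.cos_pos_of_mem_Ioo ⟨by linarith [hθ.1], by linarith [hθ.2]⟩

theorem hasDerivAt_lineParam (y t : ℝ) {θ : ℝ} (hθ : θ ∈ Set.Ioo 0 (2 * Real.pi)) :
    HasDerivAt (lineParam y t) (y * (1 / Real.cos (θ / 2 - Real.pi / 2) ^ 2 * (1 / 2))) θ := by
  have h := (Real.hasDerivAt_tan (cos_half_sub_pos hθ).ne').comp θ
    (((hasDerivAt_id θ).div_const 2).sub_const (Real.pi / 2))
  exact (h.const_mul y).const_add t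

theorem injOn_lineParam {y : ℝ} (hy : 0 < y) (t : ℝ) :
    Set.InjOn (lineParam y t) (Set.Ioo 0 (2 * Real.pi)) := by
  intro a ha b hb hab
  have h : Real.tan (a / 2 - Real.pi / 2) = Real.tan (b / 2 - Real.pi / 2) :=
    mul_left_cancel₀ hy.ne' (add_left_cancel hab)
  have := Real.injOn_tan ⟨by linarith [ha.1], by linarith [ha.2]⟩
    ⟨by linarith [hb.1], by linarith [hb.2]⟩ h
  linarith

theorem image_lineParam {y : ℝ} (hy : 0 < y) (t : ℝ) :
    lineParam y t '' Set.Ioo 0 (2 * Real.pi) = Set.univ := by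
  refine Set.eq_univ_of_forall fun x => ?_
  obtain ⟨φ, hφ, h⟩ : (x - t) / y ∈ Real.tan '' Set.Ioo (-(Real.pi / 2)) (Real.pi / 2) := by
    rw [Real.image_tan_Ioo]; trivial
  refine ⟨2 * (φ + Real.pi / 2), ⟨by linarith [hφ.1], by linarith [hφ.2]⟩, ?_⟩
  have : 2 * (φ + Real.pi / 2) / 2 - Real.pi / 2 = φ := by ring
  rw [lineParam, this, h]
  field_simp
  ring

/-- Since `1 + tan² = 1 / cos²`, the Jacobian cancels the kernel exactly and leaves `dθ / 2`, of
total mass `π`. -/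
theorem abs_deriv_mul_poissonKernelLine {y : ℝ} (hy : 0 < y) (t : ℝ) {θ : ℝ}
    (hθ : θ ∈ Set.Ioo 0 (2 * Real.pi)) :
    |y * (1 / Real.cos (θ / 2 - Real.pi / 2) ^ 2 * (1 / 2))| *
      poissonKernelLine y t (lineParam y t θ) = 1 / 2 := by
  have hc := cos_half_sub_pos hθ
  rw [abs_of_nonneg (by positivity), poissonKernelLine, lineParam, Real.tan_eq_sin_div_cos]
  generalize θ / 2 - Real.pi / 2 = φ at hc
  have hs := Real.sin_sq_add_cos_sq φ
  have : y ^ 2 + (t + y * (Real.sin φ / Real.cos φ) - t) ^ 2 = y ^ 2 / Real.cos φ ^ 2 := by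
    rw [add_sub_cancel_left]
    field_simp
    linear_combination hs
  rw [this]
  field_simp

theorem integral_poissonKernelLine_mul {y : ℝ} (hy : 0 < y) (t : ℝ) (f : ℝ → ℝ) :
    ∫ x, poissonKernelLine y t x * f x =
      1 / 2 * ∫ θ in (0 : ℝ)..2 * Real.pi, f (lineParam y t θ) := by
  have h := integral_image_eq_integral_abs_deriv_smul measurableSet_Ioo
    (fun θ hθ => (hasDerivAt_lineParam y t hθ).hasDerivWithinAt) (injOn_lineParam hy t)
    (fun x => poissonKernelLine y t x * f x)
  rw [image_lineParam hy t, setIntegral_univ] at h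
  rw [h, intervalIntegral.integral_of_le (by positivity), integral_Ioc_eq_integral_Ioo,
    ← integral_const_mul]
  refine setIntegral_congr_fun measurableSet_Ioo fun θ hθ => ?_
  simp only [smul_eq_mul]
  rw [← mul_assoc, abs_deriv_mul_poissonKernelLine hy t hθ]

theorem integrable_poissonKernelLine_mul {y : ℝ} (hy : 0 < y) (t : ℝ) {f : ℝ → ℝ}
    (hf : IntervalIntegrable (fun θ => f (lineParam y t θ)) volume 0 (2 * Real.pi)) :
    Integrable fun x => poissonKernelLine y t x * f x := by
  have h := integrableOn_image_iff_integrableOn_abs_deriv_smul measurableSet_Ioo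
    (fun θ hθ => (hasDerivAt_lineParam y t hθ).hasDerivWithinAt) (injOn_lineParam hy t)
    (fun x => poissonKernelLine y t x * f x)
  rw [image_lineParam hy t, integrableOn_univ] at h
  rw [h]
  rw [intervalIntegrable_iff_integrableOn_Ioo_of_le (by positivity)] at hf
  refine IntegrableOn.congr_fun (Integrable.const_mul hf (1 / 2)) (fun θ hθ => ?_) measurableSet_Ioo
  simp only [smul_eq_mul]
  rw [← mul_assoc, abs_deriv_mul_poissonKernelLine hy t hθ]

theorem integrable_poissonKernelLine {y : ℝ} (hy : 0 < y) (t : ℝ) :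
    Integrable (poissonKernelLine y t) := by
  simpa using integrable_poissonKernelLine_mul hy t (f := fun _ => 1) (by simp)

theorem integral_poissonKernelLine {y : ℝ} (hy : 0 < y) (t : ℝ) :
    ∫ x, poissonKernelLine y t x = Real.pi := by
  simpa using integral_poissonKernelLine_mul hy t (fun _ => 1)

/-! ### The Poisson integral of `log |s|` -/

/-- With `ζ = circleMap 0 1 θ`, the critical line is the image of the unit circle under a Möbius map
with pole `ζ = 1` and zero at `(critPt t - y) / (critPt t + y)`. Denominators are cleared; the
computation uses `ζ = -exp (2iφ)`. -/
theorem critPt_lineParam (y t : ℝ) {θ : ℝ} (hθ : θ ∈ Set.Ioo 0 (2 * Real.pi)) :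
    circleMap 0 1 θ - 1 ≠ 0 ∧ critPt (lineParam y t θ) * (circleMap 0 1 θ - 1) =
      (critPt t + y) * circleMap 0 1 θ - (critPt t - y) := by
  have hc := cos_half_sub_pos hθ
  set φ := θ / 2 - Real.pi / 2 with hφ
  have hθφ : θ = 2 * φ + Real.pi := by rw [hφ]; ring
  have hc' : Complex.cos φ ≠ 0 := by exact_mod_cast hc.ne'
  have hcm : circleMap 0 1 θ = -(Complex.cos φ + Complex.sin φ * Complex.I) ^ 2 := by
    rw [circleMap_zero, hθφ, ← Complex.exp_mul_I, ← Complex.exp_nat_mul]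
    push_cast
    rw [add_mul, Complex.exp_add, Complex.exp_pi_mul_I]
    simp [mul_assoc]
  have hs : Complex.sin φ ^ 2 = 1 - Complex.cos φ ^ 2 := by
    linear_combination Complex.sin_sq_add_cos_sq φ
  have hI := Complex.I_sq
  have h1 : circleMap 0 1 θ - 1 =
      -2 * Complex.cos φ * (Complex.cos φ + Complex.sin φ * Complex.I) := by
    rw [hcm]
    linear_combination -Complex.sin φ ^ 2 * hI + hs
  have hne : Complex.cos φ + Complex.sin φ * Complex.I ≠ 0 := by
    rw [← Complex.exp_mul_I]; exact Complex.exp_ne_zero _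
  refine ⟨by rw [h1]; simp [hc', hne], ?_⟩
  have hl : critPt (lineParam y t θ) =
      critPt t + y * (Complex.sin φ / Complex.cos φ) * Complex.I := by
    simp only [critPt, vpt, lineParam, ← hφ]
    push_cast [Complex.tan_eq_sin_div_cos]
    ring
  have h2 : (Complex.sin φ / Complex.cos φ) * Complex.cos φ = Complex.sin φ := by field_simp
  have h3 : circleMap 0 1 θ + 1 =
      -2 * Complex.sin φ * Complex.I * (Complex.cos φ + Complex.sin φ * Complex.I) := by
    rw [hcm]
    linear_combination Complex.sin φ ^ 2 * hI - hs
  rw [hl, add_mul]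
  linear_combination (y * (Complex.sin φ / Complex.cos φ) * Complex.I) * h1 - (y : ℂ) * h3 -
    2 * y * Complex.I * (Complex.cos φ + Complex.sin φ * Complex.I) * h2

theorem critPt_ne_zero (τ : ℝ) : critPt τ ≠ 0 := fun h => by
  simpa [critPt, vpt] using congrArg Complex.re h

theorem critPt_add_eq_vpt (y t : ℝ) : critPt t + y = vpt (1 / 2 + y) t := by
  simp only [critPt, vpt]; push_cast; ring

theorem norm_critPt_sub_lt {y : ℝ} (hy : 0 < y) (t : ℝ) : ‖critPt t - y‖ < ‖critPt t + y‖ := by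
  rw [← sq_lt_sq₀ (norm_nonneg _) (norm_nonneg _), ← Complex.normSq_eq_norm_sq,
    ← Complex.normSq_eq_norm_sq]
  simp [Complex.normSq_apply, critPt, vpt]
  nlinarith

theorem log_norm_critPt_lineParam {y : ℝ} (hy : 0 < y) (t : ℝ) {θ : ℝ}
    (hθ : θ ∈ Set.Ioo 0 (2 * Real.pi)) :
    Real.log ‖critPt (lineParam y t θ)‖ = Real.log ‖critPt t + y‖ +
      Real.log ‖circleMap 0 1 θ - (critPt t - y) / (critPt t + y)‖ -
      Real.log ‖circleMap 0 1 θ - 1‖ := by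
  obtain ⟨h1, h2⟩ := critPt_lineParam y t hθ
  have hA : critPt t + y ≠ 0 :=
    norm_pos_iff.1 ((norm_nonneg _).trans_lt (norm_critPt_sub_lt hy t))
  have h3 : critPt (lineParam y t θ) * (circleMap 0 1 θ - 1) =
      (critPt t + y) * (circleMap 0 1 θ - (critPt t - y) / (critPt t + y)) := by
    rw [h2]; field_simp
  have h4 : circleMap 0 1 θ - (critPt t - y) / (critPt t + y) ≠ 0 := fun h => by
    rw [h, mul_zero] at h3
    exact mul_ne_zero (critPt_ne_zero _) h1 h3
  rw [← Real.log_mul (by simpa using hA) (by simpa using h4), ← norm_mul, ← h3, norm_mul,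
    Real.log_mul (by simpa using critPt_ne_zero _) (by simpa using h1)]
  ring

theorem integrable_poissonKernelLine_mul_log {y : ℝ} (hy : 0 < y) (t : ℝ) :
    Integrable fun x => poissonKernelLine y t x * Real.log ‖critPt x‖ := by
  refine integrable_poissonKernelLine_mul hy t (f := fun x => Real.log ‖critPt x‖) ?_
  have h1 : CircleIntegrable (Real.log ‖· - (1 : ℂ)‖) 0 1 := circleIntegrable_log_norm_sub_const 1
  have h2 : CircleIntegrable (Real.log ‖· - (critPt t - y) / (critPt t + y)‖) 0 1 :=
    circleIntegrable_log_norm_sub_const 1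
  have h3 := (intervalIntegrable_const (c := Real.log ‖critPt t + y‖)).add h2 |>.sub h1
  rw [intervalIntegrable_iff_integrableOn_Ioo_of_le (by positivity)] at h3 ⊢
  exact h3.congr_fun (fun θ hθ => (log_norm_critPt_lineParam hy t hθ).symm) measurableSet_Ioo

/-- `log |s|` is the Poisson integral of its values on the critical line. -/
theorem integral_poissonKernelLine_mul_log {y : ℝ} (hy : 0 < y) (t : ℝ) :
    ∫ x, poissonKernelLine y t x * Real.log ‖critPt x‖ =
      Real.pi * Real.log ‖vpt (1 / 2 + y) t‖ := by
  have h1 : CircleIntegrable (Real.log ‖· - (1 : ℂ)‖) 0 1 := circleIntegrable_log_norm_sub_const 1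
  have h2 : CircleIntegrable (Real.log ‖· - (critPt t - y) / (critPt t + y)‖) 0 1 :=
    circleIntegrable_log_norm_sub_const 1
  have ha : ‖(critPt t - y) / (critPt t + y)‖ < 1 := by
    have h := norm_critPt_sub_lt hy t
    rw [norm_div, div_lt_one ((norm_nonneg _).trans_lt h)]
    exact h
  -- The circle mean of `log |ζ - a|` vanishes for `|a| ≤ 1`. Here `a` is first the pole on the
  -- circle, then the zero inside it, so only `log |critPt t + y|` survives.
  have e1 : ∫ θ in (0 : ℝ)..2 * Real.pi, Real.log ‖circleMap 0 1 θ - 1‖ = 0 := by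
    have h := circleAverage_log_norm_sub_const₁ (a := 1) (by simp)
    simpa [Real.circleAverage_def, Real.pi_ne_zero] using h
  have e2 : ∫ θ in (0 : ℝ)..2 * Real.pi,
      Real.log ‖circleMap 0 1 θ - (critPt t - y) / (critPt t + y)‖ = 0 := by
    have h := circleAverage_log_norm_sub_const₀ ha
    simpa [Real.circleAverage_def, Real.pi_ne_zero] using h
  have h3 : ∫ θ in (0 : ℝ)..2 * Real.pi, Real.log ‖critPt (lineParam y t θ)‖ =
      ∫ θ in (0 : ℝ)..2 * Real.pi, (Real.log ‖critPt t + y‖ +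
        Real.log ‖circleMap 0 1 θ - (critPt t - y) / (critPt t + y)‖ -
        Real.log ‖circleMap 0 1 θ - 1‖) := by
    rw [intervalIntegral.integral_of_le (by positivity),
      intervalIntegral.integral_of_le (by positivity), integral_Ioc_eq_integral_Ioo,
      integral_Ioc_eq_integral_Ioo]
    exact setIntegral_congr_fun measurableSet_Ioo fun θ hθ => log_norm_critPt_lineParam hy t hθ
  rw [integral_poissonKernelLine_mul hy t (fun x => Real.log ‖critPt x‖), h3,
    intervalIntegral.integral_sub ((intervalIntegrable_const).add h2) h1,
    intervalIntegral.integral_add intervalIntegrable_const h2, e1, e2, critPt_add_eq_vpt]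
  simp
  ring


/-! ### Fatou's theorem at Lebesgue points -/

theorem poissonKernelLine_nonneg {y : ℝ} (hy : 0 < y) (t x : ℝ) : 0 ≤ poissonKernelLine y t x := by
  unfold poissonKernelLine; positivity

/-- The Poisson kernel is dominated by a superposition of indicators of dyadic balls. -/
theorem exists_poissonKernelLine_le {y : ℝ} (hy : 0 < y) (t x : ℝ) :
    ∃ n : ℕ, x ∈ Metric.closedBall t (2 ^ n * y) ∧
      poissonKernelLine y t x ≤ 4 / (4 ^ n * y) := by
  rcases le_or_gt |x - t| y with h | h
  · refine ⟨0, by simpa [Real.dist_eq] using h, ?_⟩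
    unfold poissonKernelLine
    rw [div_le_div_iff₀ (by positivity) (by positivity)]
    nlinarith [sq_nonneg (x - t), mul_pos hy hy]
  -- Now `2 ^ n * y ≤ |x - t| < 2 ^ (n + 1) * y`. The ball has index `n + 1` while the kernel bound
  -- comes from the inner radius, hence the factor `4`.
  · obtain ⟨n, h1, h2⟩ := exists_nat_pow_near ((one_le_div hy).2 h.le) one_lt_two
    rw [le_div_iff₀ hy] at h1
    rw [div_lt_iff₀ hy] at h2
    refine ⟨n + 1, by simpa [Real.dist_eq] using h2.le, ?_⟩
    unfold poissonKernelLine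
    rw [div_le_div_iff₀ (by positivity) (by positivity)]
    have h3 : (2 ^ n * y) ^ 2 ≤ (x - t) ^ 2 := by
      rw [← sq_abs (x - t)]; exact pow_le_pow_left₀ (by positivity) h1 2
    have h4 : (4 : ℝ) ^ (n + 1) = 4 * (2 ^ n) ^ 2 := by
      rw [pow_succ, mul_comm, ← pow_mul, mul_comm n 2, pow_mul]; norm_num
    rw [h4]
    nlinarith [sq_nonneg y]

/-- If the mass of `g` on every ball of radius `r` about `t` is at most `ε r`, then the Poisson
integrals of `g` above `t` are at most `8 ε`. -/
theorem lintegral_poissonKernelLine_mul_le {y : ℝ} (hy : 0 < y) (t : ℝ) {ε : ℝ} (hε : 0 ≤ ε)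
    {g : ℝ → ENNReal} (hg : AEMeasurable g)
    (h : ∀ r > 0, ∫⁻ x in Metric.closedBall t r, g x ≤ ENNReal.ofReal (ε * r)) :
    ∫⁻ x, ENNReal.ofReal (poissonKernelLine y t x) * g x ≤ ENNReal.ofReal (8 * ε) := by
  have hpt : ∀ x, ENNReal.ofReal (poissonKernelLine y t x) * g x ≤
      ∑' n : ℕ, ENNReal.ofReal (4 / (4 ^ n * y)) *
        (Metric.closedBall t (2 ^ n * y)).indicator g x := by
    intro x
    obtain ⟨n, hn, hle⟩ := exists_poissonKernelLine_le hy t x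
    refine le_trans ?_ (ENNReal.le_tsum n)
    rw [Set.indicator_of_mem hn]
    gcongr
  have hind : ∀ n : ℕ, AEMeasurable ((Metric.closedBall t (2 ^ n * y)).indicator g) := fun n =>
    hg.indicator Metric.isClosed_closedBall.measurableSet
  -- The `n`-th ball contributes at most `4 / (4 ^ n y) · ε 2 ^ n y = 4 ε / 2 ^ n`; the sum is `8
  -- ε`.
  have hs : Summable fun n : ℕ => 4 * ε * (1 / 2 : ℝ) ^ n := summable_geometric_two.mul_left _
  calc ∫⁻ x, ENNReal.ofReal (poissonKernelLine y t x) * g x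
      ≤ ∫⁻ x, ∑' n : ℕ, ENNReal.ofReal (4 / (4 ^ n * y)) *
        (Metric.closedBall t (2 ^ n * y)).indicator g x := lintegral_mono hpt
    _ = ∑' n : ℕ, ENNReal.ofReal (4 / (4 ^ n * y)) *
        ∫⁻ x in Metric.closedBall t (2 ^ n * y), g x := by
      rw [lintegral_tsum fun n => (hind n).const_mul _]
      congr 1 with n
      rw [lintegral_const_mul'' _ (hind n),
        lintegral_indicator Metric.isClosed_closedBall.measurableSet]
    _ ≤ ∑' n : ℕ, ENNReal.ofReal (4 * ε * (1 / 2 : ℝ) ^ n) := by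
      gcongr with n
      refine (mul_le_mul_right (h _ (by positivity)) _).trans ?_
      rw [← ENNReal.ofReal_mul (by positivity)]
      apply le_of_eq
      congr 1
      have : (4 : ℝ) ^ n = 2 ^ n * 2 ^ n := by rw [← mul_pow]; norm_num
      rw [this, one_div, inv_pow]
      field_simp
    _ = ENNReal.ofReal (8 * ε) := by
      rw [← ENNReal.ofReal_tsum_of_nonneg (fun n => by positivity) hs, tsum_mul_left,
        tsum_geometric_two]
      ring_nf

theorem norm_critPt_sq (τ : ℝ) : ‖critPt τ‖ ^ 2 = 1 / 4 + τ ^ 2 := by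
  rw [← Complex.normSq_eq_norm_sq]
  simp [Complex.normSq_apply, critPt, vpt]
  ring

/-- Away from `t`, the Poisson kernel is `O(y)` times the integrating weight `1 / |s₀|²`. -/
theorem poissonKernelLine_le_of_le_abs {y δ : ℝ} (hy : 0 < y) (hδ : 0 < δ) {t x : ℝ}
    (hx : δ ≤ |x - t|) :
    poissonKernelLine y t x ≤ y * ((2 + (2 * t ^ 2 + 1) / δ ^ 2) * (1 / ‖critPt x‖ ^ 2)) := by
  have h1 : δ ^ 2 ≤ (x - t) ^ 2 := by
    rw [← sq_abs (x - t)]; exact pow_le_pow_left₀ hδ.le hx 2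
  have h2 : 0 < (x - t) ^ 2 := (by positivity : 0 < δ ^ 2).trans_le h1
  -- From `x² ≤ 2 (x - t)² + 2 t²` and `1 ≤ (x - t)² / δ²`.
  have h3 : 1 / 4 + x ^ 2 ≤ (2 + (2 * t ^ 2 + 1) / δ ^ 2) * (x - t) ^ 2 := by
    have : 2 * t ^ 2 + 1 ≤ (2 * t ^ 2 + 1) / δ ^ 2 * (x - t) ^ 2 := by
      rw [div_mul_eq_mul_div, le_div_iff₀ (by positivity)]
      gcongr
    nlinarith [sq_nonneg (x - 2 * t)]
  rw [norm_critPt_sq, poissonKernelLine, mul_one_div, ← mul_div_assoc,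
    div_le_div_iff₀ (by positivity) (by positivity)]
  rw [mul_assoc]
  gcongr
  refine h3.trans ?_
  gcongr
  nlinarith

theorem locallyIntegrable_of_integrable_div_norm_critPt_sq {k : ℝ → ℝ}
    (hk : Integrable fun τ => k τ / ‖critPt τ‖ ^ 2) : LocallyIntegrable k := by
  have hc : Continuous fun τ : ℝ => ‖critPt τ‖ ^ 2 := by
    simp_rw [norm_critPt_sq]; fun_prop
  have h := (hk.locallyIntegrable.locallyIntegrableOn Set.univ).continuousOn_mul
    hc.continuousOn isOpen_univ.isLocallyClosed
  rw [locallyIntegrableOn_univ] at h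
  refine h.congr (Eventually.of_forall fun τ => ?_)
  have := critPt_ne_zero τ
  field_simp

/-- Convergence of the Poisson integral at Lebesgue points. -/
theorem tendsto_poissonIntegral_of_lebesguePoint {k : ℝ → ℝ}
    (hk : Integrable fun τ => k τ / ‖critPt τ‖ ^ 2)
    (hki : ∀ y > 0, ∀ t, Integrable fun x => poissonKernelLine y t x * k x) {t : ℝ}
    (ht : Tendsto (fun r => ⨍ x in Metric.closedBall t r, ‖k x - k t‖) (𝓝[>] 0) (𝓝 0)) :
    Tendsto (fun y => ∫ x, poissonKernelLine y t x * k x) (𝓝[>] 0) (𝓝 (Real.pi * k t)) := by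
  have hloc := locallyIntegrable_of_integrable_div_norm_critPt_sq hk
  have hgloc : LocallyIntegrable fun x => ‖k x - k t‖ := fun x =>
    ((hloc.sub (locallyIntegrable_const (k t))) x).norm
  have hwt : Integrable fun x : ℝ => 1 / ‖critPt x‖ ^ 2 := by
    have h := integrable_poissonKernelLine (y := 1 / 2) (by norm_num) 0
    refine (h.const_mul 2).congr (Eventually.of_forall fun x => ?_)
    simp only [norm_critPt_sq, poissonKernelLine]
    ring
  have hgw : Integrable fun x => ‖k x - k t‖ * (1 / ‖critPt x‖ ^ 2) := by
    refine (hk.sub (hwt.const_mul (k t))).norm.congr (Eventually.of_forall fun x => ?_)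
    simp only [Pi.sub_apply]
    rw [show k x / ‖critPt x‖ ^ 2 - k t * (1 / ‖critPt x‖ ^ 2) =
      (k x - k t) * (1 / ‖critPt x‖ ^ 2) by ring, norm_mul,
      Real.norm_of_nonneg (by positivity : 0 ≤ 1 / ‖critPt x‖ ^ 2)]
  have hgi : ∀ y > 0, Integrable fun x => poissonKernelLine y t x * ‖k x - k t‖ := fun y hy => by
    refine ((hki y hy t).sub ((integrable_poissonKernelLine hy t).mul_const (k t))).norm.congr
      (Eventually.of_forall fun x => ?_)
    simp only [Pi.sub_apply]
    rw [← mul_sub, norm_mul, Real.norm_of_nonneg (poissonKernelLine_nonneg hy t x)]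
  rw [Metric.tendsto_nhds]
  intro e he
  -- Half of `e` is for the part near `t`, half for the rest. The `2` in `2 * ε` is the length `2 r`
  -- of a ball of radius `r`.
  obtain ⟨ε, hε, hεe⟩ : ∃ ε > 0, 8 * (2 * ε) < e / 2 := ⟨e / 64, by positivity, by linarith⟩
  obtain ⟨δ, hδ, hδr⟩ : ∃ δ > 0, ∀ r, 0 < r → r ≤ δ →
      ∫ x in Metric.closedBall t r, ‖k x - k t‖ ≤ 2 * ε * r := by
    have h := ht.eventually_lt_const hε
    obtain ⟨δ, hδ, h⟩ := mem_nhdsGT_iff_exists_Ioc_subset.1 h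
    refine ⟨δ, hδ, fun r hr hrδ => ?_⟩
    have := h ⟨hr, hrδ⟩
    simp only [Set.mem_ofPred_eq, setAverage_eq, smul_eq_mul] at this
    rw [Real.volume_real_closedBall hr.le, inv_mul_lt_iff₀ (by positivity)] at this
    linarith
  set B := Metric.closedBall t δ with hB
  have hBm : MeasurableSet B := Metric.isClosed_closedBall.measurableSet
  have near : ∀ y > 0, ∫ x in B, poissonKernelLine y t x * ‖k x - k t‖ ≤ 8 * (2 * ε) := by
    intro y hy
    have hgm : AEMeasurable (B.indicator fun x => ENNReal.ofReal ‖k x - k t‖) :=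
      (hgloc.aestronglyMeasurable.aemeasurable.ennreal_ofReal).indicator hBm
    have hl := lintegral_poissonKernelLine_mul_le hy t (ε := 2 * ε) (by positivity) hgm ?_
    · rw [integral_eq_lintegral_of_nonneg_ae
        (Eventually.of_forall fun x => mul_nonneg (poissonKernelLine_nonneg hy t x) (norm_nonneg _))
        (hgi y hy).integrableOn.aestronglyMeasurable]
      refine ENNReal.toReal_le_of_le_ofReal (by positivity) (le_trans (le_of_eq ?_) hl)
      rw [← lintegral_indicator hBm]
      congr 1 with x
      by_cases hx : x ∈ B
      · simp [hx, ENNReal.ofReal_mul (poissonKernelLine_nonneg hy t x)]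
      · simp [hx]
    · intro r hr
      rw [lintegral_indicator hBm, Measure.restrict_restrict hBm]
      -- Cutting `k - k t` off outside `B` makes the mass bound, known only for `r ≤ δ`, valid at
      -- all radii.
      have hsub : B ∩ Metric.closedBall t r ⊆ Metric.closedBall t (min r δ) := fun x hx =>
        Metric.mem_closedBall.2 (le_min hx.2 hx.1)
      refine (lintegral_mono_set hsub).trans ?_
      rw [← ofReal_integral_eq_lintegral_ofReal
        (hgloc.integrableOn_isCompact (isCompact_closedBall _ _))
        (Eventually.of_forall fun x => norm_nonneg _)]
      refine ENNReal.ofReal_le_ofReal ((hδr _ (lt_min hr hδ) (min_le_right _ _)).trans ?_)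
      gcongr
      exact min_le_left _ _
  set M := (2 + (2 * t ^ 2 + 1) / δ ^ 2) * ∫ x, ‖k x - k t‖ * (1 / ‖critPt x‖ ^ 2) with hM
  have far : ∀ y > 0, ∫ x in Bᶜ, poissonKernelLine y t x * ‖k x - k t‖ ≤ y * M := by
    intro y hy
    calc ∫ x in Bᶜ, poissonKernelLine y t x * ‖k x - k t‖
        ≤ ∫ x in Bᶜ, y * ((2 + (2 * t ^ 2 + 1) / δ ^ 2) *
            (‖k x - k t‖ * (1 / ‖critPt x‖ ^ 2))) := by
          refine setIntegral_mono_on (hgi y hy).integrableOn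
            ((hgw.const_mul _).const_mul _).integrableOn hBm.compl fun x hx => ?_
          have hx' : δ ≤ |x - t| := by
            rw [hB, Set.mem_compl_iff, Metric.mem_closedBall, not_le, Real.dist_eq] at hx
            exact hx.le
          refine (mul_le_mul_of_nonneg_right (poissonKernelLine_le_of_le_abs hy hδ hx')
            (norm_nonneg _)).trans (le_of_eq ?_)
          ring
      _ ≤ ∫ x, y * ((2 + (2 * t ^ 2 + 1) / δ ^ 2) *
            (‖k x - k t‖ * (1 / ‖critPt x‖ ^ 2))) :=
          setIntegral_le_integral ((hgw.const_mul _).const_mul _)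
            (Eventually.of_forall fun x => by simp only [Pi.zero_apply]; positivity)
      _ = y * M := by rw [integral_const_mul, integral_const_mul]
  have hsmall : ∀ᶠ y in 𝓝[>] (0 : ℝ), y * M < e / 2 := by
    have : Tendsto (fun y : ℝ => y * M) (𝓝[>] 0) (𝓝 0) := by
      have h : Tendsto (fun y : ℝ => y * M) (𝓝 0) (𝓝 (0 * M)) := tendsto_id.mul_const M
      rw [zero_mul] at h
      exact h.mono_left nhdsWithin_le_nhds
    exact this.eventually_lt_const (by positivity)
  filter_upwards [hsmall, self_mem_nhdsWithin] with y hyM hy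
  have hy : 0 < y := hy
  have hdiff : (∫ x, poissonKernelLine y t x * k x) - Real.pi * k t =
      ∫ x, poissonKernelLine y t x * (k x - k t) := by
    rw [← integral_poissonKernelLine hy t, ← integral_mul_const, ← integral_sub (hki y hy t)
      ((integrable_poissonKernelLine hy t).mul_const _)]
    simp_rw [mul_sub]
  rw [Real.dist_eq, hdiff, ← Real.norm_eq_abs]
  calc ‖∫ x, poissonKernelLine y t x * (k x - k t)‖
      ≤ ∫ x, ‖poissonKernelLine y t x * (k x - k t)‖ := norm_integral_le_integral_norm _
    _ = ∫ x, poissonKernelLine y t x * ‖k x - k t‖ := by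
      congr 1 with x
      rw [norm_mul, Real.norm_of_nonneg (poissonKernelLine_nonneg hy t x)]
    _ = (∫ x in B, poissonKernelLine y t x * ‖k x - k t‖) +
        ∫ x in Bᶜ, poissonKernelLine y t x * ‖k x - k t‖ :=
      (integral_add_compl hBm (hgi y hy)).symm
    _ < e := by linarith [near y hy, far y hy]

theorem ae_tendsto_poissonIntegral {k : ℝ → ℝ}
    (hk : Integrable fun τ => k τ / ‖critPt τ‖ ^ 2)
    (hki : ∀ y > 0, ∀ t, Integrable fun x => poissonKernelLine y t x * k x) :
    ∀ᵐ t, Tendsto (fun y => ∫ x, poissonKernelLine y t x * k x) (𝓝[>] 0)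
      (𝓝 (Real.pi * k t)) := by
  filter_upwards [IsUnifLocDoublingMeasure.ae_tendsto_average_norm_sub volume
    (locallyIntegrable_of_integrable_div_norm_critPt_sq hk) 1] with t ht
  refine tendsto_poissonIntegral_of_lebesguePoint hk hki
    (ht (fun _ => t) id tendsto_id ?_)
  filter_upwards [self_mem_nhdsWithin] with r hr
  simpa using (Set.mem_Ioi.1 hr).le


/-! ### The Schwarz kernel and the modulus of outer functions -/

theorem critPt_sub_vpt_ne_zero {y : ℝ} (hy : 0 < y) (t x : ℝ) :
    critPt x - vpt (1 / 2 + y) t ≠ 0 := fun h => by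
  have := congrArg Complex.re h
  simp [critPt, vpt] at this
  exact hy.ne' this

theorem vpt_mem_halfPlane {y : ℝ} (hy : 0 < y) (t : ℝ) : vpt (1 / 2 + y) t ∈ halfPlane := by
  simp only [halfPlane, vpt, Set.mem_ofPred_eq]
  simpa using hy

/-- In this form `s₀` enters only through `1 / (s₀ - s)`, so continuity and boundedness along the
critical line are immediate. -/
theorem schwarzKernel_eq {y : ℝ} (hy : 0 < y) (t x : ℝ) :
    (toDisc (critPt x) + toDisc (vpt (1 / 2 + y) t)) /
        (toDisc (critPt x) - toDisc (vpt (1 / 2 + y) t)) =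
      (2 * vpt (1 / 2 + y) t - 1) + (2 * vpt (1 / 2 + y) t ^ 2 - 2 * vpt (1 / 2 + y) t) /
        (critPt x - vpt (1 / 2 + y) t) := by
  have h0 := critPt_ne_zero x
  have h1 : vpt (1 / 2 + y) t ≠ 0 := by
    rw [← critPt_add_eq_vpt]
    exact norm_pos_iff.1 ((norm_nonneg _).trans_lt (norm_critPt_sub_lt hy t))
  have h2 := critPt_sub_vpt_ne_zero hy t x
  unfold toDisc
  generalize critPt x = a at *
  generalize vpt (1 / 2 + y) t = s at *
  have h3 : (a - 1) / a - (s - 1) / s = (a - s) / (a * s) := by field_simp; ring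
  rw [h3]
  field_simp
  ring

/-- The factor `|s₀|²` cancels the weight in `IsOuter`; the factor `2` turns `1 / 2π` into `1 / π`,
matching the kernel's mass `π`. -/
theorem schwarzKernel_re {y : ℝ} (hy : 0 < y) (t x : ℝ) :
    ((toDisc (critPt x) + toDisc (vpt (1 / 2 + y) t)) /
        (toDisc (critPt x) - toDisc (vpt (1 / 2 + y) t))).re =
      2 * poissonKernelLine y t x * ‖critPt x‖ ^ 2 := by
  have hp : 0 < y ^ 2 + (x - t) ^ 2 := by positivity
  have hn : Complex.normSq (critPt x - vpt (1 / 2 + y) t) = y ^ 2 + (x - t) ^ 2 := by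
    simp [Complex.normSq_apply, critPt, vpt]
    ring
  rw [schwarzKernel_eq hy, Complex.add_re, Complex.div_re, hn, norm_critPt_sq, poissonKernelLine]
  simp [critPt, vpt, pow_two]
  rw [pow_two] at hp
  field_simp
  ring

theorem norm_schwarzKernel_le {y : ℝ} (hy : 0 < y) (t x : ℝ) :
    ‖(toDisc (critPt x) + toDisc (vpt (1 / 2 + y) t)) /
        (toDisc (critPt x) - toDisc (vpt (1 / 2 + y) t))‖ ≤
      ‖2 * vpt (1 / 2 + y) t - 1‖ + ‖2 * vpt (1 / 2 + y) t ^ 2 - 2 * vpt (1 / 2 + y) t‖ / y := by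
  have hle : y ≤ ‖critPt x - vpt (1 / 2 + y) t‖ := by
    have h := Complex.abs_re_le_norm (critPt x - vpt (1 / 2 + y) t)
    simp only [critPt, vpt] at h ⊢
    simp [abs_of_pos hy] at h
    simpa using h
  rw [schwarzKernel_eq hy]
  refine (norm_add_le _ _).trans ?_
  rw [norm_div]
  gcongr

theorem continuous_schwarzKernel {y : ℝ} (hy : 0 < y) (t : ℝ) :
    Continuous fun x : ℝ => (toDisc (critPt x) + toDisc (vpt (1 / 2 + y) t)) /
        (toDisc (critPt x) - toDisc (vpt (1 / 2 + y) t)) := by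
  simp_rw [schwarzKernel_eq hy]
  have hc : Continuous critPt := by unfold critPt vpt; fun_prop
  exact continuous_const.add (continuous_const.div (hc.sub continuous_const)
    (critPt_sub_vpt_ne_zero hy t))

theorem integrable_schwarzKernel_mul {k : ℝ → ℝ}
    (hk : Integrable fun τ => k τ / ‖critPt τ‖ ^ 2) {y : ℝ} (hy : 0 < y) (t : ℝ) :
    Integrable fun x : ℝ => (toDisc (critPt x) + toDisc (vpt (1 / 2 + y) t)) /
        (toDisc (critPt x) - toDisc (vpt (1 / 2 + y) t)) * ((k x / ‖critPt x‖ ^ 2 : ℝ) : ℂ) :=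
  hk.ofReal.bdd_mul (continuous_schwarzKernel hy t).aestronglyMeasurable
    (Eventually.of_forall (norm_schwarzKernel_le hy t))

theorem schwarzKernel_mul_re {y : ℝ} (hy : 0 < y) (t : ℝ) (k : ℝ → ℝ) (x : ℝ) :
    ((toDisc (critPt x) + toDisc (vpt (1 / 2 + y) t)) /
        (toDisc (critPt x) - toDisc (vpt (1 / 2 + y) t)) *
          ((k x / ‖critPt x‖ ^ 2 : ℝ) : ℂ)).re = 2 * (poissonKernelLine y t x * k x) := by
  have := critPt_ne_zero x
  rw [Complex.re_mul_ofReal, schwarzKernel_re hy]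
  field_simp

theorem integrable_poissonKernelLine_mul_of_integrable_div {k : ℝ → ℝ}
    (hk : Integrable fun τ => k τ / ‖critPt τ‖ ^ 2) {y : ℝ} (hy : 0 < y) (t : ℝ) :
    Integrable fun x => poissonKernelLine y t x * k x := by
  refine ((integrable_schwarzKernel_mul hk hy t).re.const_mul (1 / 2)).congr
    (Eventually.of_forall fun x => ?_)
  have h := schwarzKernel_mul_re hy t k x
  simp only [RCLike.re_to_complex]
  rw [h]
  ring

/-- The modulus of an outer function is the exponential of the Poisson integral of `k`. -/
theorem norm_outer_eq {c : ℂ} (hc : ‖c‖ = 1) {k : ℝ → ℝ}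
    (hk : Integrable fun τ => k τ / ‖critPt τ‖ ^ 2) {y : ℝ} (hy : 0 < y) (t : ℝ) :
    ‖c * Complex.exp (1 / (2 * (Real.pi : ℂ)) *
      ∫ τ : ℝ, (toDisc (critPt τ) + toDisc (vpt (1 / 2 + y) t)) /
        (toDisc (critPt τ) - toDisc (vpt (1 / 2 + y) t)) *
          ((k τ / ‖critPt τ‖ ^ 2 : ℝ) : ℂ))‖ =
      Real.exp (1 / Real.pi * ∫ x, poissonKernelLine y t x * k x) := by
  have hre := integral_re (integrable_schwarzKernel_mul hk hy t)
  simp only [RCLike.re_to_complex, schwarzKernel_mul_re hy t k] at hre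
  rw [integral_const_mul] at hre
  have hpi : (1 / (2 * (Real.pi : ℂ))) = ((1 / (2 * Real.pi) : ℝ) : ℂ) := by push_cast; rfl
  rw [norm_mul, hc, one_mul, Complex.norm_exp, hpi, Complex.re_ofReal_mul, ← hre]
  congr 1
  field_simp

/-! ### Boundary values and conclusion -/

theorem tendsto_half_add : Tendsto (fun y : ℝ => 1 / 2 + y) (𝓝[>] 0) (𝓝[>] (1 / 2)) := by
  refine tendsto_nhdsWithin_iff.2 ⟨?_, ?_⟩
  · have h : Tendsto (fun y : ℝ => 1 / 2 + y) (𝓝 0) (𝓝 (1 / 2 + 0)) :=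
      tendsto_id.const_add (1 / 2)
    rw [add_zero] at h
    exact h.mono_left nhdsWithin_le_nhds
  · filter_upwards [self_mem_nhdsWithin] with y hy
    simpa using hy

theorem vpt_mem_halfPlane_of_lt {σ : ℝ} (hσ : 1 / 2 < σ) (τ : ℝ) : vpt σ τ ∈ halfPlane := by
  simpa using vpt_mem_halfPlane (sub_pos.2 hσ) τ

/-- A quotient by an inner function has boundary values of the same modulus. -/
theorem HasBoundaryValue.of_inner_mul {F J G : ℂ → ℂ} (h : ∀ s ∈ halfPlane, F s = J s * G s)
    {τ : ℝ} {z u : ℂ} (hz : HasBoundaryValue F τ z) (hu : HasBoundaryValue J τ u)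
    (hu1 : ‖u‖ = 1) : HasBoundaryValue G τ (z / u) := by
  have hu0 : u ≠ 0 := norm_ne_zero_iff.1 (by rw [hu1]; norm_num)
  refine (hz.div hu hu0).congr' ?_
  filter_upwards [hu.eventually_ne hu0, self_mem_nhdsWithin] with σ hσ hσ'
  rw [Pi.div_apply, h _ (vpt_mem_halfPlane_of_lt hσ' τ), mul_div_cancel_left₀ _ hσ]

theorem lemma2p2 (F : ℂ → ℂ) (hF : MemHardyTwo F) (K : ℝ)
    (hFK : IsBigOOnCriticalLine F K) (Fout : ℂ → ℂ) (hout : IsOuterFactor F Fout) :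
    IsBigOOnClosedHalfPlane Fout K := by
  obtain ⟨C, hC⟩ := hFK
  obtain ⟨⟨c, k, hc, hk, hG⟩, J, ⟨-, -, hJ⟩, hFJ⟩ := hout
  have hki : ∀ y > 0, ∀ t, Integrable fun x => poissonKernelLine y t x * k x :=
    fun y hy t => integrable_poissonKernelLine_mul_of_integrable_div hk hy t
  have hnorm : ∀ y > 0, ∀ t, ‖Fout (vpt (1 / 2 + y) t)‖ =
      Real.exp (1 / Real.pi * ∫ x, poissonKernelLine y t x * k x) := fun y hy t => by
    rw [hG _ (vpt_mem_halfPlane hy t)]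
    exact norm_outer_eq hc hk hy t
  have hbd : ∀ᵐ τ : ℝ, ∃ z : ℂ, HasBoundaryValue Fout τ z ∧ ‖z‖ ≤ C * ‖critPt τ‖ ^ K := by
    filter_upwards [hC, hJ] with τ ⟨z, hz, hzC⟩ ⟨u, hu, hu1⟩
    exact ⟨z / u, hz.of_inner_mul hFJ hu hu1, by rwa [norm_div, hu1, div_one]⟩
  -- The modulus of `Fout` along a horizontal line tends both to `‖z‖` and to `exp (k τ)`, so the
  -- two agree.
  have hkexp : ∀ᵐ τ : ℝ, Real.exp (k τ) ≤ C * ‖critPt τ‖ ^ K := by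
    filter_upwards [hbd, ae_tendsto_poissonIntegral hk hki] with τ ⟨z, hz, hzC⟩ hτ
    have h1 : Tendsto (fun y : ℝ => ‖Fout (vpt (1 / 2 + y) τ)‖) (𝓝[>] 0) (𝓝 ‖z‖) :=
      (Tendsto.comp hz tendsto_half_add).norm
    have h2 : Tendsto (fun y : ℝ => ‖Fout (vpt (1 / 2 + y) τ)‖) (𝓝[>] 0)
        (𝓝 (Real.exp (k τ))) := by
      have h := (Real.continuous_exp.tendsto _).comp (hτ.const_mul (1 / Real.pi))
      rw [← mul_assoc, one_div_mul_cancel Real.pi_ne_zero, one_mul] at h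
      refine h.congr' ?_
      filter_upwards [self_mem_nhdsWithin] with y hy
      exact (hnorm y hy τ).symm
    rwa [tendsto_nhds_unique h2 h1]
  -- `C` must be positive because it bounds an exponential at some point; this allows taking
  -- logarithms.
  have hCpos : 0 < C := by
    obtain ⟨τ, hτ⟩ := hkexp.exists
    exact pos_of_mul_pos_left ((Real.exp_pos _).trans_le hτ) (by positivity)
  have hkle : ∀ᵐ τ : ℝ, k τ ≤ Real.log C + K * Real.log ‖critPt τ‖ := by
    filter_upwards [hkexp] with τ hτ
    have h0 : 0 < ‖critPt τ‖ := norm_pos_iff.2 (critPt_ne_zero τ)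
    rw [← Real.log_rpow h0, ← Real.log_mul hCpos.ne' (by positivity)]
    exact (Real.le_log_iff_exp_le (by positivity)).2 hτ
  refine ⟨C, fun s hs => ?_, hbd⟩
  obtain ⟨y, hy, t, rfl⟩ : ∃ y > 0, ∃ t, s = vpt (1 / 2 + y) t :=
    ⟨s.re - 1 / 2, sub_pos.2 hs, s.im, by simp [vpt, Complex.re_add_im]⟩
  have hs0 : 0 < ‖vpt (1 / 2 + y) t‖ := by
    rw [← critPt_add_eq_vpt]
    exact (norm_nonneg _).trans_lt (norm_critPt_sub_lt hy t)
  have hint : ∫ x, poissonKernelLine y t x * k x ≤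
      Real.pi * (Real.log C + K * Real.log ‖vpt (1 / 2 + y) t‖) := by
    have i1 := (integrable_poissonKernelLine hy t).mul_const (Real.log C)
    have i2 := (integrable_poissonKernelLine_mul_log hy t).const_mul K
    calc ∫ x, poissonKernelLine y t x * k x
        ≤ ∫ x, (poissonKernelLine y t x * Real.log C +
          K * (poissonKernelLine y t x * Real.log ‖critPt x‖)) := by
          refine integral_mono_ae (hki y hy t) (i1.add i2) ?_
          filter_upwards [hkle] with x hx
          refine (mul_le_mul_of_nonneg_left hx (poissonKernelLine_nonneg hy t x)).trans
            (le_of_eq ?_)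
          ring
      _ = Real.pi * (Real.log C + K * Real.log ‖vpt (1 / 2 + y) t‖) := by
          rw [integral_add i1 i2, integral_mul_const, integral_const_mul,
            integral_poissonKernelLine hy, integral_poissonKernelLine_mul_log hy]
          ring
  rw [hnorm y hy t]
  calc Real.exp (1 / Real.pi * ∫ x, poissonKernelLine y t x * k x)
      ≤ Real.exp (1 / Real.pi *
          (Real.pi * (Real.log C + K * Real.log ‖vpt (1 / 2 + y) t‖))) := by gcongr
    _ = C * ‖vpt (1 / 2 + y) t‖ ^ K := by
        rw [← mul_assoc, one_div_mul_cancel Real.pi_ne_zero, one_mul, ← Real.log_rpow hs0,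
          ← Real.log_mul hCpos.ne' (by positivity), Real.exp_log (by positivity)]
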